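/- Let $K\ge M\ge 2$ be integers, let $q$ be a prime power, $l\ge 1$, and $L=l\log_2 q$. A server stores $K$ messages $X_1,\dots,X_K$ that are independent and uniform on $\mathbb{F}_{q^l}$. Independently of the messages, let $S$ be a uniformly random $M$-subset of $\{1,\dots,K\}$, let $C=(c_i)_{i\in S}$ be independent of $S$ and uniform on the sequences of $M$ nonzero elements of $\mathbb{F}_q$, and, given $(S,C)$, let the demand index $W$ be uniform on $S$. The user knows $W,S,C$ and the side information $Y=\sum_{i\in S}c_iX_i$. A protocol consists of a discrete random query $Q$ whose law is a function of $(W,S,C)$ and which is independent of the messages given $(W,S,C)$, and of an answer $A$ which is a deterministic function of $Q$ and $X_1,\dots,X_K$. It is a PIR-CSI--II protocol if it satisfies $W$-privacy, i.e. $\mathbb{P}(W=w\mid Q=Q_0)=\mathbb{P}(W=w)$ for every $w\in\{1,\dots,K\}$ and every query $Q_0$ of positive probability, and recoverability, i.e. $H(X_W\mid A,Q,Y,W,S,C)=0$. Its rate is $L/H(A)$, where $H$ denotes Shannon entropy in bits. It is scalar-linear if the answer is a finite list of linear combinations of $X_1,\dots,X_K$ whose coefficients lie in $\mathbb{F}_q$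 and are determined by the query. The capacity (respectively, the scalar-linear capacity) of the PIR-CSI--II setting is the supremum of the rates of all (respectively, all scalar-linear) PIR-CSI--II protocols, over all $q$ and $l$. **Theorem.** If $M=2$ or $M=K$, then the capacity and the scalar-linear capacity of the PIR-CSI--II setting are both equal to $1$. If $3\le M\le K-1$, they are both equal to $1/2$. -/

import Mathlib

open scoped ENNReal

noncomputable section

namespace PIRCSI

/-! ### Shannon entropy (in bits) of discrete random variables on a discrete probability space -/

section Entropy

variable {Ω α β : Type} (μ : PMF Ω)

/-- Shannon entropy `H(U) = ∑ P(U = u) log₂ (1 / P(U = u))`, with values in `[0, ∞]`. -/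
def entropy (U : Ω → α) : ℝ≥0∞ :=
  ∑' u : α, ENNReal.ofReal (((μ.map U) u).toReal * Real.logb 2 (1 / ((μ.map U) u).toReal))

/-- Conditional Shannon entropy
`H(U | V) = ∑ P(U = u, V = v) log₂ (P(V = v) / P(U = u, V = v))`, with values in `[0, ∞]`. -/
def condEntropy (U : Ω → α) (V : Ω → β) : ℝ≥0∞ :=
  ∑' p : α × β, ENNReal.ofReal
    (((μ.map fun ω => (U ω, V ω)) p).toReal *
      Real.logb 2 (((μ.map V) p.2).toReal / ((μ.map fun ω => (U ω, V ω)) p).toReal))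

end Entropy

/-! ### Supports, coefficients and the law of demand and side information -/

/-- The possible support index sets of the side information: the `M`-subsets of the `K` indices. -/
abbrev Support (K M : ℕ) : Type := {S : Finset (Fin K) // S.card = M}

/-- A support index set `S` with one nonzero coefficient `c_i ∈ F` for every `i ∈ S`. -/
abbrev SideInfo (K M : ℕ) (F : Type) [Field F] : Type :=
  Σ S : Support K M, ({i // i ∈ S.1} → Fˣ)

theorem support_nonempty {K M : ℕ} (hMK : M ≤ K) : Nonempty (Support K M) := by
  obtain ⟨S, _, hS⟩ := Finset.exists_subset_card_eq (s := (Finset.univ : Finset (Fin K))) (n := M)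
    (by simpa using hMK)
  exact ⟨⟨S, hS⟩⟩

theorem Support.nonempty {K M : ℕ} (hM : 1 ≤ M) (S : Support K M) : S.1.Nonempty := by
  rw [← Finset.card_pos, S.2]; exact hM

open Classical in
/-- The joint law of the demand index `W`, the support `S` and the coefficients `C` in Model II:
`S` is uniform on the `M`-subsets, `C` is uniform, and given `S` (and `C`) the demand index `W`
is uniform on `S`. In particular `W ∈ S` holds almost surely. -/
def instanceLaw {K M : ℕ} (hM : 1 ≤ M) (hMK : M ≤ K) (F : Type) [Field F] [Fintype F] :
    PMF (Fin K × SideInfo K M F) :=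
  haveI := support_nonempty hMK
  (PMF.uniformOfFintype (Support K M)).bind fun S =>
    (PMF.uniformOfFintype ({i // i ∈ S.1} → Fˣ)).bind fun C =>
      (PMF.uniformOfFinset S.1 (S.nonempty hM)).map fun W => (W, ⟨S, C⟩)

/-- The coded side information `Y = ∑_{i ∈ S} c_i X_i`. -/
def codedSideInfo {K M : ℕ} {F E : Type} [Field F] [Field E] [Algebra F E]
    (T : SideInfo K M F) (X : Fin K → E) : E :=
  ∑ i : {i // i ∈ T.1.1}, (T.2 i : F) • X i

/-! ### Protocols -/

/-- A protocol for retrieving one of `K` messages from `E = 𝔽_{q^l}`, where the coefficients of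
the side information lie in `F = 𝔽_q`. The query is a stochastic function of `(W, S, C)`; the
answer is a deterministic function of the query and of the messages. (The indicator of `W ∈ S` is
known to be `1` throughout.) -/
structure Protocol (K M : ℕ) (F E : Type) [Field F] [Field E] [Algebra F E] where
  /-- the alphabet of the queries -/
  Query : Type
  /-- the alphabet of the answers -/
  Answer : Type
  /-- the law of the query for given `W` and `(S, C)` -/
  query : Fin K → SideInfo K M F → PMF Query
  /-- the answer of the server -/
  answer : Query → (Fin K → E) → Answer

namespace Protocol

variable {K M : ℕ} {F E : Type} [Field F] [Fintype F] [Field E] [Fintype E] [Algebra F E]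

/-- The sample space: `(W, (S, C))`, the query, and the messages `X_1, …, X_K`. -/
abbrev Outcome (P : Protocol K M F E) : Type :=
  (Fin K × SideInfo K M F) × P.Query × (Fin K → E)

/-- The joint law of `(W, (S, C))`, `Q` and the messages. The messages are independent, uniform on
`E`, and independent of `(W, S, C, Q)`. -/
def law (hM : 1 ≤ M) (hMK : M ≤ K) (P : Protocol K M F E) : PMF P.Outcome :=
  (instanceLaw hM hMK F).bind fun I =>
    (P.query I.1 I.2).bind fun Q =>
      (PMF.uniformOfFintype (Fin K → E)).map fun X => (I, Q, X)

section RandomVariables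

variable (P : Protocol K M F E)

/-- the demand index -/
def demand (ω : P.Outcome) : Fin K := ω.1.1

/-- the support and the coefficients of the side information -/
def side (ω : P.Outcome) : SideInfo K M F := ω.1.2

/-- the query -/
def sentQuery (ω : P.Outcome) : P.Query := ω.2.1

/-- the messages -/
def messages (ω : P.Outcome) : Fin K → E := ω.2.2

/-- the answer -/
def sentAnswer (ω : P.Outcome) : P.Answer := P.answer (P.sentQuery ω) (P.messages ω)

end RandomVariables

/-- `W`-privacy: `P(W = w | Q = q) = P(W = w)` for every demand index `w` and every query `q` of
positive probability. -/
def IsWPrivate (hM : 1 ≤ M) (hMK : M ≤ K) (P : Protocol K M F E) : Prop :=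
  ∀ (w : Fin K) (q : P.Query), ((P.law hM hMK).map P.sentQuery) q ≠ 0 →
    ((P.law hM hMK).map fun ω => (P.demand ω, P.sentQuery ω)) (w, q) /
        ((P.law hM hMK).map P.sentQuery) q =
      ((P.law hM hMK).map P.demand) w

/-- Recoverability: `H(X_W | A, Q, Y, W, S, C) = 0`. -/
def IsRecoverable (hM : 1 ≤ M) (hMK : M ≤ K) (P : Protocol K M F E) : Prop :=
  condEntropy (P.law hM hMK) (fun ω => P.messages ω (P.demand ω))
    (fun ω => (P.sentAnswer ω, P.sentQuery ω, codedSideInfo (P.side ω) (P.messages ω),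
      P.demand ω, P.side ω)) = 0

/-- The entropy `L = l log₂ q` of one message, where `q = |F|` and `l = [E : F]`. -/
def messageEntropy (F E : Type) [Field F] [Fintype F] [Field E] [Algebra F E] : ℝ :=
  (Module.finrank F E : ℝ) * Real.logb 2 (Fintype.card F : ℝ)

/-- The rate `L / H(A)`. -/
def rate (hM : 1 ≤ M) (hMK : M ≤ K) (P : Protocol K M F E) : ℝ≥0∞ :=
  ENNReal.ofReal (messageEntropy F E) / entropy (P.law hM hMK) P.sentAnswer

/-- A protocol is scalar-linear if the answer consists of (i.e. is, up to an injective relabelling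
of the alphabet, a finite list of) linear combinations of the messages with scalar coefficients
in `F = 𝔽_q`, which are determined by the query. -/
def IsScalarLinear (P : Protocol K M F E) : Prop :=
  ∃ (e : P.Answer ↪ List E) (coef : P.Query → List (Fin K → F)),
    ∀ (q : P.Query) (X : Fin K → E),
      e (P.answer q X) = (coef q).map fun c => ∑ i, c i • X i

end Protocol

/-! ### Capacities -/

/-- The capacity of the PIR-CSI–II setting: the supremum of the rates of all `W`-private and
recoverable protocols, over all base fields `F = 𝔽_q` and all finite extensions `E = 𝔽_{q^l}`. -/
def capacity (K M : ℕ) (hM : 1 ≤ M) (hMK : M ≤ K) : ℝ≥0∞ :=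
  sSup {r : ℝ≥0∞ | ∃ (F E : Type) (_ : Field F) (_ : Fintype F) (_ : Field E) (_ : Fintype E)
    (_ : Algebra F E) (P : Protocol K M F E),
      P.IsWPrivate hM hMK ∧ P.IsRecoverable hM hMK ∧ r = P.rate hM hMK}

/-- The scalar-linear capacity of the PIR-CSI–II setting: the same supremum, over scalar-linear
protocols only. -/
def scalarLinearCapacity (K M : ℕ) (hM : 1 ≤ M) (hMK : M ≤ K) : ℝ≥0∞ :=
  sSup {r : ℝ≥0∞ | ∃ (F E : Type) (_ : Field F) (_ : Fintype F) (_ : Field E) (_ : Fintype E)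
    (_ : Algebra F E) (P : Protocol K M F E),
      P.IsScalarLinear ∧ P.IsWPrivate hM hMK ∧ P.IsRecoverable hM hMK ∧ r = P.rate hM hMK}

end PIRCSI

end

/-! Converse. By `Protocol.rate_le`, it suffices to bound the fibres of the answer for each possible
query: fibres of size at most `|E|^(K-n)` force `H(A) ≥ nL`. On a fibre, the side information
determines the demanded message. So translating the fibre along a direction orthogonal to the side
information, with entry 1 at the demand, gives `|E|` disjoint copies, and the rate is at most 1. By
privacy a query is compatible with every demand `w`, through some side information `T w`. If `3 ≤ M
< K`, two demands `w`, `v` can be chosen so that a second direction is orthogonal to both `T w` and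
`T v`, with entry 1 at `v` and 0 at `w`. The fibre then has `|E|^2` disjoint translates, and the
rate is at most 1/2.

Achievability, over `ZMod 3`. For a uniform index `i`, `mask w i` is a bijection from the weight-`M`
vectors nonzero at `w` onto those nonzero at `i`, so `i` and the masked vector reveal nothing about
`w`. Subtracting the masked combination from the side information isolates `X_w`, up to a term in
`X_i` that appears when `i` is outside the support. Sending `X_i` as well costs a factor 2. It is
not needed if `M = K`, where `i` is always in the support, nor if `M = 2`, where the entry at `i`
can be deleted. -/

noncomputable section

namespace PIRCSI

/-! ### Entropy: vanishing and bounds. -/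

section Entropy

variable {Ω α β : Type} (μ : PMF Ω)

theorem map_apply_ne_zero_iff (U : Ω → α) (a : α) :
    (μ.map U) a ≠ 0 ↔ ∃ ω ∈ μ.support, U ω = a := by
  rw [← PMF.mem_support_iff, PMF.mem_support_map_iff]

theorem map_prod_apply_add_le (U : Ω → α) (V : Ω → β) {u u' : α} (h : u ≠ u') (v : β) :
    (μ.map fun ω => (U ω, V ω)) (u, v) + (μ.map fun ω => (U ω, V ω)) (u', v) ≤ (μ.map V) v := by
  classical
  rw [PMF.map_apply, PMF.map_apply, PMF.map_apply, ← ENNReal.tsum_add]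
  refine ENNReal.tsum_le_tsum fun ω => ?_
  simp only [Prod.mk.injEq]
  by_cases hv : v = V ω
  · by_cases hu : u = U ω
    · have : u' ≠ U ω := fun h' => h (hu.trans h'.symm)
      rw [if_pos ⟨hu, hv⟩, if_neg fun h => this h.1, if_pos hv, add_zero]
    · by_cases hu' : u' = U ω <;> simp [hv, hu, hu']
  · simp [hv]

theorem condEntropy_eq_zero_iff (U : Ω → α) (V : Ω → β) :
    condEntropy μ U V = 0 ↔
      ∀ ω ∈ μ.support, ∀ ω' ∈ μ.support, V ω = V ω' → U ω = U ω' := by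
  have key : ∀ p : α × β, (μ.map fun ω => (U ω, V ω)) p ≠ 0 →
      0 < ((μ.map fun ω => (U ω, V ω)) p).toReal := fun p hp =>
    ENNReal.toReal_pos hp (PMF.apply_ne_top _ _)
  rw [condEntropy, ENNReal.tsum_eq_zero]
  constructor
  · intro h ω hω ω' hω' hV
    by_contra hU
    have h1 : (μ.map fun ω => (U ω, V ω)) (U ω, V ω) ≠ 0 :=
      (map_apply_ne_zero_iff _ _ _).2 ⟨ω, hω, rfl⟩
    have h2 : (μ.map fun ω => (U ω, V ω)) (U ω', V ω) ≠ 0 :=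
      (map_apply_ne_zero_iff _ _ _).2 ⟨ω', hω', by rw [hV]⟩
    have h3 := map_prod_apply_add_le μ U V hU (V ω)
    have h3' := ENNReal.toReal_mono (PMF.apply_ne_top _ _) h3
    rw [ENNReal.toReal_add (PMF.apply_ne_top _ _) (PMF.apply_ne_top _ _)] at h3'
    have h1' := key _ h1
    have h2' := key _ h2
    have h4 := h (U ω, V ω)
    rw [ENNReal.ofReal_eq_zero] at h4
    refine absurd h4 (not_le.2 (mul_pos h1' (Real.logb_pos one_lt_two ?_)))
    rw [one_lt_div h1']
    linarith
  · rintro h ⟨u, v⟩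
    by_cases h0 : (μ.map fun ω => (U ω, V ω)) (u, v) = 0
    · simp [h0]
    · suffices (μ.map V) v = (μ.map fun ω => (U ω, V ω)) (u, v) by
        simp only [this]
        rw [div_self (key _ h0).ne']
        simp
      obtain ⟨ω, hω, hp⟩ := (map_apply_ne_zero_iff _ _ _).1 h0
      rw [Prod.mk.injEq] at hp
      classical
      rw [PMF.map_apply, PMF.map_apply]
      refine tsum_congr fun ω' => ?_
      by_cases hω' : μ ω' = 0
      · simp [hω']
      · by_cases hv : v = V ω'
        · have := h ω hω ω' hω' (hp.2.trans hv)
          simp [hv, ← hp.1, this]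
        · simp [hv]

theorem le_entropy (U : Ω → α) {N : ℕ} (hN : 0 < N) (h : ∀ a, (μ.map U) a ≤ (N : ℝ≥0∞)⁻¹) :
    ENNReal.ofReal (Real.logb 2 N) ≤ entropy μ U := by
  -- Spread `log₂ N` over the atoms as `∑ p(a) log₂ N`, to compare term by term.
  rw [← one_mul (ENNReal.ofReal _), ← PMF.tsum_coe (μ.map U), ← ENNReal.tsum_mul_right, entropy]
  refine ENNReal.tsum_le_tsum fun a => ?_
  by_cases h0 : (μ.map U) a = 0
  · simp [h0]
  have hpos : 0 < ((μ.map U) a).toReal := ENNReal.toReal_pos h0 (PMF.apply_ne_top _ _)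
  nth_rewrite 1 [← ENNReal.ofReal_toReal (PMF.apply_ne_top (μ.map U) a)]
  rw [← ENNReal.ofReal_mul hpos.le]
  refine ENNReal.ofReal_le_ofReal (mul_le_mul_of_nonneg_left ?_ hpos.le)
  have hN' : (0 : ℝ) < N := by exact_mod_cast hN
  refine Real.logb_le_logb_of_le one_lt_two hN' ?_
  rw [le_one_div hN' hpos]
  have := ENNReal.toReal_mono (by simp [hN.ne']) (h a)
  simpa using this

theorem entropy_le [Fintype α] [Nonempty α] (U : Ω → α) :
    entropy μ U ≤ ENNReal.ofReal (Real.logb 2 (Fintype.card α)) := by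
  set N : ℝ := ((Fintype.card α : ℕ) : ℝ) with hN
  have hNpos : 0 < N := by rw [hN]; exact_mod_cast Fintype.card_pos
  set p : α → ℝ := fun a => ((μ.map U) a).toReal with hp
  have hp0 : ∀ a, 0 ≤ p a := fun a => ENNReal.toReal_nonneg
  have hp1 : ∀ a, p a ≤ 1 := fun a => by
    rw [hp, ← ENNReal.toReal_one]
    exact ENNReal.toReal_mono ENNReal.one_ne_top (PMF.coe_le_one (μ.map U) a)
  have hsum : ∑ a, p a = 1 := by
    rw [hp, ← ENNReal.toReal_sum fun a _ => PMF.apply_ne_top _ _,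
      ← tsum_fintype (L := .unconditional α), PMF.tsum_coe, ENNReal.toReal_one]
  have hlog2 : 0 < Real.log 2 := Real.log_pos one_lt_two
  rw [entropy, tsum_fintype, ← ENNReal.ofReal_sum_of_nonneg]
  · refine ENNReal.ofReal_le_ofReal ?_
    -- This is `log t ≤ t - 1` at `t = 1 / (N p(a))`; the correction terms sum to zero.
    have hterm : ∀ a, p a * Real.logb 2 (1 / p a) ≤
        p a * Real.logb 2 N + (1 / N - p a) / Real.log 2 := fun a => by
      rcases (hp0 a).eq_or_lt with h0 | h0
      · rw [← h0]; simp only [zero_mul, zero_add, sub_zero]; positivity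
      · have h1 := Real.log_le_sub_one_of_pos (show 0 < 1 / (N * p a) by positivity)
        have h2 : Real.log (1 / p a) = Real.log N + Real.log (1 / (N * p a)) := by
          rw [← Real.log_mul hNpos.ne' (by positivity)]
          congr 1
          field_simp
        rw [Real.logb, Real.logb, h2, ← mul_div_assoc, ← mul_div_assoc, ← add_div]
        refine div_le_div_of_nonneg_right ?_ hlog2.le
        have h3 : p a * (1 / (N * p a) - 1) = 1 / N - p a := by field_simp
        nlinarith [mul_le_mul_of_nonneg_left h1 h0.le]
    refine (Finset.sum_le_sum fun a _ => hterm a).trans (le_of_eq ?_)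
    rw [Finset.sum_add_distrib, ← Finset.sum_mul, hsum, ← Finset.sum_div, Finset.sum_sub_distrib,
      hsum]
    simp [← hN, hNpos.ne']
  · intro a _
    rcases (hp0 a).eq_or_lt with h0 | h0
    · simp only [hp] at h0
      rw [← h0, zero_mul]
    · exact mul_nonneg (hp0 a) (Real.logb_nonneg one_lt_two ((one_le_div h0).2 (hp1 a)))

end Entropy

/-! ### Pointwise estimates for laws; the law of demand and side information. -/

theorem PMF_bind_apply_le {α β : Type} (p : PMF α) (f : α → PMF β) (b : β) {c : ℝ≥0∞}
    (h : ∀ a ∈ p.support, f a b ≤ c) : (p.bind f) b ≤ c := by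
  rw [PMF.bind_apply]
  calc ∑' a, p a * f a b ≤ ∑' a, p a * c := by
        refine ENNReal.tsum_le_tsum fun a => ?_
        by_cases h0 : p a = 0
        · simp [h0]
        · exact mul_le_mul_right (h a h0) _
    _ = c := by rw [ENNReal.tsum_mul_right, PMF.tsum_coe, one_mul]

theorem uniformOfFintype_map_apply_le {α β : Type} [Fintype α] [Nonempty α] (f : α → β) (b : β)
    {N : ℕ} (hN : 0 < N) (h : Nat.card {x // f x = b} * N ≤ Fintype.card α) :
    ((PMF.uniformOfFintype α).map f) b ≤ (N : ℝ≥0∞)⁻¹ := by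
  classical
  rw [PMF.map_apply, tsum_fintype]
  simp only [PMF.uniformOfFintype_apply]
  rw [← Finset.sum_filter, Finset.sum_const, nsmul_eq_mul]
  have hc : (Finset.univ.filter fun x => b = f x).card = Nat.card {x // f x = b} := by
    rw [Nat.card_eq_fintype_card, Fintype.card_subtype]
    simp only [eq_comm]
  rw [hc, ← div_eq_mul_inv]
  refine ENNReal.div_le_of_le_mul ?_
  rw [mul_comm, ← div_eq_mul_inv, ENNReal.le_div_iff_mul_le (by simp [hN.ne']) (by simp)]
  exact_mod_cast h

open Classical in
-- All supports have `M` elements, so the three uniform choices multiply to the same weight for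
-- every admissible pair. Privacy thus reduces to unweighted sums over side informations.
theorem exists_instanceLaw_apply {K M : ℕ} (hM : 1 ≤ M) (hMK : M ≤ K) (F : Type) [Field F]
    [Fintype F] : ∃ κ : ℝ≥0∞, κ ≠ 0 ∧ ∀ (w : Fin K) (T : SideInfo K M F),
      instanceLaw hM hMK F (w, T) = if w ∈ T.1.1 then κ else 0 := by
  have := support_nonempty hMK
  refine ⟨(Fintype.card (Support K M) : ℝ≥0∞)⁻¹ *
    (((Fintype.card Fˣ ^ M : ℕ) : ℝ≥0∞)⁻¹ * (M : ℝ≥0∞)⁻¹), ?_, ?_⟩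
  · simp
  rintro w ⟨S, C⟩
  rw [instanceLaw, PMF.bind_apply, tsum_eq_single S]
  · rw [PMF.bind_apply, tsum_eq_single C]
    · rw [PMF.map_apply, tsum_eq_single w]
      · simp only [if_true, PMF.uniformOfFintype_apply, PMF.uniformOfFinset_apply, Fintype.card_fun,
          Fintype.card_coe, S.2]
        split_ifs <;> simp
      · intro w' hw'
        simp [hw'.symm]
    · intro C' hC'
      rw [PMF.map_apply]
      simp [hC'.symm]
  · intro S' hS'
    rw [PMF.bind_apply]
    simp only [PMF.map_apply]
    simp [hS'.symm]

theorem mem_support_instanceLaw {K M : ℕ} (hM : 1 ≤ M) (hMK : M ≤ K) {F : Type} [Field F]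
    [Fintype F] (w : Fin K) (T : SideInfo K M F) :
    (w, T) ∈ (instanceLaw hM hMK F).support ↔ w ∈ T.1.1 := by
  obtain ⟨κ, hκ, h⟩ := exists_instanceLaw_apply hM hMK F
  rw [PMF.mem_support_iff, h]
  simp [hκ]

theorem exists_mem_support {K M : ℕ} (hM : 1 ≤ M) (hMK : M ≤ K) (w : Fin K) :
    ∃ S : Support K M, w ∈ S.1 := by
  obtain ⟨S, hwS, -, hS⟩ := Finset.exists_subsuperset_card_eq (s := {w})
    (t := (Finset.univ : Finset (Fin K))) (n := M) (Finset.subset_univ _) (by simpa using hM)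
    (by simpa using hMK)
  exact ⟨⟨S, hS⟩, by simpa using hwS⟩

/-! ### Privacy, recoverability and rate in terms of supports and fibres. -/

namespace Protocol

variable {K M : ℕ} {F E : Type} [Field F] [Fintype F] [Field E] [Fintype E] [Algebra F E]
variable (hM : 1 ≤ M) (hMK : M ≤ K) (P : Protocol K M F E)

theorem mem_support_law {w : Fin K} {T : SideInfo K M F} {q : P.Query} {X : Fin K → E} :
    ((w, T), q, X) ∈ (P.law hM hMK).support ↔ w ∈ T.1.1 ∧ q ∈ (P.query w T).support := by
  simp only [law, PMF.mem_support_bind_iff, PMF.mem_support_map_iff]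
  constructor
  · rintro ⟨⟨w', T'⟩, hI, q', hq, X', -, h⟩
    simp only [Prod.mk.injEq] at h
    obtain ⟨⟨rfl, rfl⟩, rfl, rfl⟩ := h
    exact ⟨(mem_support_instanceLaw hM hMK _ _).1 hI, hq⟩
  · rintro ⟨hw, hq⟩
    exact ⟨(w, T), (mem_support_instanceLaw hM hMK _ _).2 hw, q, hq, X, PMF.mem_support_uniformOfFintype X, rfl⟩

theorem map_demand_apply_ne_zero (w : Fin K) : ((P.law hM hMK).map P.demand) w ≠ 0 := by
  obtain ⟨S, hS⟩ := exists_mem_support hM hMK w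
  let T : SideInfo K M F := ⟨S, fun _ => 1⟩
  obtain ⟨q, hq⟩ := (P.query w T).support_nonempty
  exact (map_apply_ne_zero_iff _ _ _).2
    ⟨((w, T), q, fun _ => 0), (P.mem_support_law hM hMK).2 ⟨hS, hq⟩, rfl⟩

/-- By privacy, every query that may occur is compatible with every demand. -/
theorem IsWPrivate.exists_side {P : Protocol K M F E} {hM : 1 ≤ M} {hMK : M ≤ K}
    (hP : P.IsWPrivate hM hMK) {w₀ : Fin K} {T₀ : SideInfo K M F} (h₀ : w₀ ∈ T₀.1.1) {q : P.Query}
    (hq : q ∈ (P.query w₀ T₀).support) (w : Fin K) :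
    ∃ T : SideInfo K M F, w ∈ T.1.1 ∧ q ∈ (P.query w T).support := by
  have hq0 : ((P.law hM hMK).map P.sentQuery) q ≠ 0 := (map_apply_ne_zero_iff _ _ _).2
    ⟨((w₀, T₀), q, fun _ => 0), (P.mem_support_law hM hMK).2 ⟨h₀, hq⟩, rfl⟩
  have h1 := hP w q hq0
  -- A zero joint probability would force `P(W = w) = 0`.
  have h2 : ((P.law hM hMK).map fun ω => (P.demand ω, P.sentQuery ω)) (w, q) ≠ 0 := fun h => by
    rw [h, ENNReal.zero_div] at h1
    exact P.map_demand_apply_ne_zero hM hMK w h1.symm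
  obtain ⟨⟨⟨w', T⟩, q', X⟩, hω, h⟩ := (map_apply_ne_zero_iff _ _ _).1 h2
  simp only [demand, sentQuery, Prod.mk.injEq] at h
  obtain ⟨rfl, rfl⟩ := h
  exact ⟨T, (P.mem_support_law hM hMK).1 hω⟩

theorem isRecoverable_iff : P.IsRecoverable hM hMK ↔
    ∀ (w : Fin K) (T : SideInfo K M F), w ∈ T.1.1 → ∀ q ∈ (P.query w T).support,
      ∀ X X' : Fin K → E, P.answer q X = P.answer q X' → codedSideInfo T X = codedSideInfo T X' →
        X w = X' w := by
  rw [IsRecoverable, condEntropy_eq_zero_iff]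
  constructor
  · intro h w T hw q hq X X' hA hY
    refine h ((w, T), q, X) ((P.mem_support_law hM hMK).2 ⟨hw, hq⟩) ((w, T), q, X')
      ((P.mem_support_law hM hMK).2 ⟨hw, hq⟩) ?_
    simp only [sentAnswer, sentQuery, messages, side, demand, hA, hY]
  · rintro h ⟨⟨w, T⟩, q, X⟩ hω ⟨⟨w', T'⟩, q', X'⟩ hω' hV
    simp only [sentAnswer, sentQuery, messages, side, demand, Prod.mk.injEq] at hV
    obtain ⟨hA, rfl, hY, rfl, rfl⟩ := hV
    rw [mem_support_law] at hω
    exact h w T hω.1 q hω.2 X X' hA hY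

theorem map_sentAnswer_apply_le {N : ℕ} (hN : 0 < N)
    (h : ∀ (w : Fin K) (T : SideInfo K M F), w ∈ T.1.1 → ∀ q ∈ (P.query w T).support,
      ∀ a, Nat.card {X // P.answer q X = a} * N ≤ Fintype.card (Fin K → E)) (a : P.Answer) :
    ((P.law hM hMK).map P.sentAnswer) a ≤ (N : ℝ≥0∞)⁻¹ := by
  rw [law, PMF.map_bind]
  refine PMF_bind_apply_le _ _ _ ?_
  rintro ⟨w, T⟩ hI
  rw [mem_support_instanceLaw] at hI
  rw [PMF.map_bind]
  refine PMF_bind_apply_le _ _ _ fun q hq => ?_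
  rw [PMF.map_comp]
  exact uniformOfFintype_map_apply_le (P.answer q) a hN (h w T hI q hq a)

theorem messageEntropy_eq : messageEntropy F E = Real.logb 2 (Fintype.card E) := by
  rw [messageEntropy, Module.card_eq_pow_finrank (K := F) (V := E), Nat.cast_pow,
    Real.logb_pow]

theorem messageEntropy_pos : 0 < messageEntropy F E := by
  rw [messageEntropy_eq]
  exact Real.logb_pos one_lt_two (by exact_mod_cast Fintype.one_lt_card)

/-- Given any query, each answer has probability at most `|E|^(-n)`; averaging over queries keeps
this bound. -/
theorem rate_le {n : ℕ} (hn : 0 < n)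
    (h : ∀ (w : Fin K) (T : SideInfo K M F), w ∈ T.1.1 → ∀ q ∈ (P.query w T).support,
      ∀ a, Nat.card {X // P.answer q X = a} * Fintype.card E ^ n ≤ Fintype.card (Fin K → E)) :
    P.rate hM hMK ≤ 1 / n := by
  have hL := messageEntropy_pos (F := F) (E := E)
  have hH := le_entropy (P.law hM hMK) P.sentAnswer (N := Fintype.card E ^ n)
    (pow_pos Fintype.card_pos n)
    (P.map_sentAnswer_apply_le hM hMK (pow_pos Fintype.card_pos n) h)
  rw [Nat.cast_pow, Real.logb_pow, ← messageEntropy_eq (F := F), ENNReal.ofReal_mul (by positivity),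
    ENNReal.ofReal_natCast] at hH
  rw [rate]
  have hL0 : ENNReal.ofReal (messageEntropy F E) ≠ 0 := by simpa using hL
  calc _ ≤ ENNReal.ofReal (messageEntropy F E) / (n * ENNReal.ofReal (messageEntropy F E)) :=
        ENNReal.div_le_div_left hH _
    _ = 1 / n := by
        nth_rewrite 1 [← one_mul (ENNReal.ofReal _)]
        exact ENNReal.mul_div_mul_right _ _ hL0 ENNReal.ofReal_ne_top

theorem le_rate {n : ℕ} (e : P.Answer ≃ (Fin n → E)) : 1 / n ≤ P.rate hM hMK := by
  have hL := messageEntropy_pos (F := F) (E := E)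
  have : Fintype P.Answer := Fintype.ofEquiv _ e.symm
  have : Nonempty P.Answer := ⟨e.symm 0⟩
  have hH := entropy_le (P.law hM hMK) P.sentAnswer
  rw [Fintype.card_congr e, Fintype.card_fun, Fintype.card_fin, Nat.cast_pow, Real.logb_pow,
    ← messageEntropy_eq (F := F), ENNReal.ofReal_mul (by positivity),
    ENNReal.ofReal_natCast] at hH
  rw [rate]
  have hL0 : ENNReal.ofReal (messageEntropy F E) ≠ 0 := by simpa using hL
  calc 1 / (n : ℝ≥0∞)
      = ENNReal.ofReal (messageEntropy F E) / (n * ENNReal.ofReal (messageEntropy F E)) := by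
        rw [← ENNReal.mul_div_mul_right _ _ hL0 ENNReal.ofReal_ne_top, one_mul]
    _ ≤ _ := ENNReal.div_le_div_left hH _

end Protocol

/-! ### Side information as coefficient vectors of weight `M`. -/

namespace SideInfo

variable {K M : ℕ} {F E : Type} [Field F] [Field E] [Algebra F E]

/-- The coefficients of the side information, extended by zero outside of the support. -/
def coeff (T : SideInfo K M F) (k : Fin K) : F :=
  if h : k ∈ T.1.1 then (T.2 ⟨k, h⟩ : F) else 0

theorem coeff_ne_zero_iff (T : SideInfo K M F) (k : Fin K) : coeff T k ≠ 0 ↔ k ∈ T.1.1 := by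
  unfold coeff
  split_ifs with h <;> simp [h]

theorem coeff_eq_zero (T : SideInfo K M F) {k : Fin K} (h : k ∉ T.1.1) : coeff T k = 0 :=
  dif_neg h

theorem coeff_injective : Function.Injective (coeff : SideInfo K M F → Fin K → F) := by
  intro T T' h
  have hS : T.1 = T'.1 := Subtype.ext <| Finset.ext fun k => by
    rw [← coeff_ne_zero_iff, ← coeff_ne_zero_iff, h]
  obtain ⟨S, C⟩ := T
  obtain ⟨S', C'⟩ := T'
  obtain rfl : S = S' := hS
  congr 1
  ext ⟨k, hk⟩
  simpa [coeff, hk] using congrFun h k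

theorem exists_coeff_eq [DecidableEq F] (c : Fin K → F)
    (hc : (Finset.univ.filter fun k => c k ≠ 0).card = M) : ∃ T : SideInfo K M F, coeff T = c := by
  refine ⟨⟨⟨Finset.univ.filter fun k => c k ≠ 0, hc⟩, fun k => Units.mk0 (c k) ?_⟩, ?_⟩
  · exact (Finset.mem_filter.1 k.2).2
  · ext k
    by_cases h : c k = 0 <;> simp [coeff, h]

theorem codedSideInfo_eq (T : SideInfo K M F) (X : Fin K → E) :
    codedSideInfo T X = ∑ k, coeff T k • X k := by
  have h0 : ∑ k, coeff T k • X k = ∑ k ∈ T.1.1, coeff T k • X k :=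
    (Finset.sum_subset (Finset.subset_univ _) fun k _ hk => by
      rw [coeff_eq_zero T hk, zero_smul]).symm
  rw [h0, ← Finset.sum_coe_sort, codedSideInfo]
  refine Finset.sum_congr rfl fun k _ => ?_
  rw [coeff, dif_pos k.2]

theorem codedSideInfo_add_smul (T : SideInfo K M F) (X : Fin K → E) (d : Fin K → F) (s : E) :
    codedSideInfo T (fun k => X k + d k • s) = codedSideInfo T X + (coeff T ⬝ᵥ d) • s := by
  simp only [codedSideInfo_eq, smul_add, Finset.sum_add_distrib, dotProduct, Finset.sum_smul,
    mul_smul]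

end SideInfo

/-! ### Orthogonal directions and families of supports. -/

theorem exists_dotProduct_eq_zero {ι F : Type} [Fintype ι] [DecidableEq ι] [Field F] {b : ι → F}
    {w j : ι} (hj : j ≠ w) (hb : b j ≠ 0) : ∃ d : ι → F, d w = 1 ∧ b ⬝ᵥ d = 0 := by
  refine ⟨Pi.single w 1 + Pi.single j (-b w / b j), by simp [hj.symm], ?_⟩
  simp only [dotProduct_add, dotProduct_single]
  field_simp
  ring

/-- The system is triangular: since `z i = 0`, the entry at `j` settles the equation for `z`, and
then the entry at `i` settles the one for `y`. -/
theorem exists_dotProduct_eq_zero₂ {ι F : Type} [Fintype ι] [DecidableEq ι] [Field F]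
    {y z : ι → F} {v w i j : ι} (hvw : v ≠ w) (hiv : i ≠ v) (hiw : i ≠ w) (hjv : j ≠ v)
    (hjw : j ≠ w) (hyi : y i ≠ 0) (hzi : z i = 0) (hzj : z j ≠ 0) :
    ∃ d : ι → F, d v = 1 ∧ d w = 0 ∧ y ⬝ᵥ d = 0 ∧ z ⬝ᵥ d = 0 := by
  refine ⟨Pi.single v 1 + Pi.single j (-z v / z j) +
    Pi.single i (-(y v + y j * (-z v / z j)) / y i), ?_, ?_, ?_, ?_⟩
  · simp [hiv.symm, hjv.symm]
  · simp [hvw.symm, hiw.symm, hjw.symm]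
  · simp only [dotProduct_add, dotProduct_single]
    field_simp
    ring
  · simp only [dotProduct_add, dotProduct_single, hzi]
    field_simp
    ring

/-- Otherwise `S a` and `S b` always agree off `{a, b}`, and equal cardinalities make the relation
`b ∈ S a` symmetric. For `u ∉ S w` and `v ∈ S w` with `v ≠ w`, this gives `v ∈ S u`, hence `u ∈ S
v`, hence `u ∈ S w`. -/
theorem exists_sdiff_pair_ne {ι : Type} [Fintype ι] [DecidableEq ι] {M : ℕ} (hM : 2 ≤ M)
    (hMK : M < Fintype.card ι) (S : ι → Finset ι) (hS : ∀ w, w ∈ S w) (hcard : ∀ w, (S w).card = M) :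
    ∃ w v, v ≠ w ∧ ∃ i, i ≠ v ∧ i ≠ w ∧ ¬ (i ∈ S w ↔ i ∈ S v) := by
  by_contra! h
  have hnss : ∀ a b, ¬ S a ⊂ S b := fun a b hab =>
    (Finset.card_lt_card hab).ne ((hcard a).trans (hcard b).symm)
  have hexch : ∀ a b, b ∈ S a → a ∈ S b := fun a b hba => by
    by_contra hab
    have hne : b ≠ a := fun e => hab (e ▸ hS a)
    -- If `a ∉ S b`, agreement off `{a, b}` makes `S b` a proper subset of `S a`.
    refine hnss b a ⟨fun i hi => ?_, fun hsub => hab (hsub (hS a))⟩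
    by_cases hib : i = b
    · rwa [hib]
    · exact (h a b hne i hib fun e => hab (e ▸ hi)).2 hi
  have hpos : 0 < Fintype.card ι := by omega
  obtain ⟨w⟩ := Fintype.card_pos_iff.1 hpos
  obtain ⟨u, hu⟩ : ∃ u, u ∉ S w := by
    by_contra! hall
    have := hcard w
    rw [Finset.eq_univ_of_forall hall, Finset.card_univ] at this
    omega
  obtain ⟨v, hv, hvw⟩ := Finset.exists_mem_ne (by rw [hcard]; omega : 1 < (S w).card) w
  have huw : u ≠ w := fun e => hu (e ▸ hS w)
  have hvu : v ≠ u := fun e => hu (e ▸ hv)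
  have h1 : v ∈ S u := (h w u huw v hvu hvw).1 hv
  have h2 : u ∈ S v := hexch u v h1
  exact hu ((h w v hvw u hvu.symm huw).2 h2)

/-! ### Counting translates of a fibre. -/

section Fibres

variable {K M : ℕ} {F E : Type} [Field F] [Field E] [Fintype E] [Algebra F E]

/-- A translate `X + s d` has the same side information as `X`, which gives `X w`; the entry at `w`
then reveals `s`. -/
theorem card_fibre_mul_le {C : (Fin K → E) → Prop} {T : SideInfo K M F} {w : Fin K}
    (hC : ∀ X X', C X → C X' → codedSideInfo T X = codedSideInfo T X' → X w = X' w)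
    {d : Fin K → F} (hd : d w = 1) (hT : SideInfo.coeff T ⬝ᵥ d = 0) :
    Nat.card {X // C X} * Fintype.card E ≤ Fintype.card (Fin K → E) := by
  rw [← Nat.card_eq_fintype_card, ← Nat.card_eq_fintype_card, ← Nat.card_prod]
  refine Nat.card_le_card_of_injective
    (fun p : {X // C X} × E => fun k => p.1.1 k + d k • p.2) ?_
  rintro ⟨⟨X, hX⟩, s⟩ ⟨⟨X', hX'⟩, s'⟩ h
  dsimp only at h
  have h1 := congrArg (codedSideInfo T) h
  rw [SideInfo.codedSideInfo_add_smul, SideInfo.codedSideInfo_add_smul, hT, zero_smul, zero_smul,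
    add_zero, add_zero] at h1
  have h2 := hC X X' hX hX' h1
  have h3 := congrFun h w
  simp only [h2, hd, one_smul, add_right_inj] at h3
  subst h3
  have h4 : X = X' := funext fun k => add_right_cancel (congrFun h k)
  subst h4
  rfl

/-- Decode `X + t d' + s d` successively. Neither shift changes the side information of `T`, and `d'
w = 0`, so the entry at `w` gives `s`. After removing `s d`, the vector `T'` and the entry at `v`
give `t`. -/
theorem card_fibre_mul_sq_le {C : (Fin K → E) → Prop} {T T' : SideInfo K M F} {w v : Fin K}
    (hC : ∀ X X', C X → C X' → codedSideInfo T X = codedSideInfo T X' → X w = X' w)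
    (hC' : ∀ X X', C X → C X' → codedSideInfo T' X = codedSideInfo T' X' → X v = X' v)
    {d d' : Fin K → F} (hd : d w = 1) (hT : SideInfo.coeff T ⬝ᵥ d = 0)
    (hd' : d' v = 1) (hdw' : d' w = 0) (hT' : SideInfo.coeff T ⬝ᵥ d' = 0)
    (hTT' : SideInfo.coeff T' ⬝ᵥ d' = 0) :
    Nat.card {X // C X} * Fintype.card E ^ 2 ≤ Fintype.card (Fin K → E) := by
  rw [sq, ← Nat.card_eq_fintype_card, ← Nat.card_eq_fintype_card, ← Nat.card_prod, ← Nat.card_prod]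
  refine Nat.card_le_card_of_injective
    (fun p : {X // C X} × E × E => fun k => (p.1.1 k + d' k • p.2.2) + d k • p.2.1) ?_
  rintro ⟨⟨X, hX⟩, s, t⟩ ⟨⟨X', hX'⟩, s', t'⟩ h
  dsimp only at h
  have h1 := congrArg (codedSideInfo T) h
  simp only [SideInfo.codedSideInfo_add_smul, hT, hT', zero_smul, add_zero] at h1
  have h2 := hC X X' hX hX' h1
  have h3 := congrFun h w
  simp only [h2, hd, hdw', zero_smul, one_smul, add_right_inj] at h3
  subst h3
  have h4 : (fun k => X k + d' k • t) = fun k => X' k + d' k • t' :=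
    funext fun k => add_right_cancel (congrFun h k)
  have h5 := congrArg (codedSideInfo T') h4
  simp only [SideInfo.codedSideInfo_add_smul, hTT', zero_smul, add_zero] at h5
  have h6 := hC' X X' hX hX' h5
  have h7 := congrFun h4 v
  simp only [h6, hd', one_smul, add_right_inj] at h7
  subst h7
  have h8 : X = X' := funext fun k => add_right_cancel (congrFun h4 k)
  subst h8
  rfl

end Fibres

/-! ### Converse bounds on the rate. -/

namespace Protocol

theorem exists_direction {K M : ℕ} (hM : 2 ≤ M) {F : Type} [Field F] (T : SideInfo K M F) (w : Fin K) :
    ∃ d : Fin K → F, d w = 1 ∧ SideInfo.coeff T ⬝ᵥ d = 0 := by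
  obtain ⟨j, hj, hjw⟩ := Finset.exists_mem_ne (by rw [T.1.2]; omega : 1 < T.1.1.card) w
  exact exists_dotProduct_eq_zero hjw ((SideInfo.coeff_ne_zero_iff T j).2 hj)

theorem exists_direction_pair {K M : ℕ} (hM : 3 ≤ M) (hMK : M < K) {F : Type} [Field F]
    (T : Fin K → SideInfo K M F)
    (hT : ∀ w, w ∈ (T w).1.1) :
    ∃ (w v : Fin K) (d : Fin K → F), d v = 1 ∧ d w = 0 ∧
      SideInfo.coeff (T w) ⬝ᵥ d = 0 ∧ SideInfo.coeff (T v) ⬝ᵥ d = 0 := by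
  obtain ⟨w, v, hvw, i, hiv, hiw, h⟩ := exists_sdiff_pair_ne (by omega : 2 ≤ M) (by simpa using hMK)
    (fun w => (T w).1.1) hT (fun w => (T w).1.2)
  -- Here `M ≥ 3` is essential: a support of size 2 could be `{v, w}`.
  have hthird : ∀ u, ∃ j ∈ (T u).1.1, j ≠ v ∧ j ≠ w := fun u => by
    obtain ⟨j, hj, hj'⟩ := Finset.exists_mem_notMem_of_card_lt_card (s := {v, w}) (t := (T u).1.1)
      (by rw [(T u).1.2]; exact Finset.card_le_two.trans_lt (by omega))
    simp only [Finset.mem_insert, Finset.mem_singleton, not_or] at hj'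
    exact ⟨j, hj, hj'⟩
  by_cases hi : i ∈ (T w).1.1
  · have hi' : i ∉ (T v).1.1 := fun hi' => h ⟨fun _ => hi', fun _ => hi⟩
    obtain ⟨j, hj, hjv, hjw⟩ := hthird v
    obtain ⟨d, h1, h2, h3, h4⟩ := exists_dotProduct_eq_zero₂ hvw hiv hiw hjv hjw
      ((SideInfo.coeff_ne_zero_iff _ _).2 hi) (SideInfo.coeff_eq_zero _ hi')
      ((SideInfo.coeff_ne_zero_iff _ _).2 hj)
    exact ⟨w, v, d, h1, h2, h3, h4⟩
  · have hi' : i ∈ (T v).1.1 := by tauto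
    obtain ⟨j, hj, hjv, hjw⟩ := hthird w
    obtain ⟨d, h1, h2, h3, h4⟩ := exists_dotProduct_eq_zero₂ hvw hiv hiw hjv hjw
      ((SideInfo.coeff_ne_zero_iff _ _).2 hi') (SideInfo.coeff_eq_zero _ hi)
      ((SideInfo.coeff_ne_zero_iff _ _).2 hj)
    exact ⟨w, v, d, h1, h2, h4, h3⟩

variable {K M : ℕ} {F E : Type} [Field F] [Fintype F] [Field E] [Fintype E] [Algebra F E]

theorem rate_le_one (hM : 2 ≤ M) (hM' : 1 ≤ M) (hMK : M ≤ K) (P : Protocol K M F E)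
    (hR : P.IsRecoverable hM' hMK) : P.rate hM' hMK ≤ 1 := by
  rw [isRecoverable_iff] at hR
  refine (P.rate_le hM' hMK one_pos fun w T hw q hq a => ?_).trans_eq (by simp)
  obtain ⟨d, hd, hTd⟩ := exists_direction hM T w
  rw [pow_one]
  exact card_fibre_mul_le (fun X X' hX hX' => hR w T hw q hq X X' (hX.trans hX'.symm)) hd hTd

theorem rate_le_half (hM : 3 ≤ M) (hM' : 1 ≤ M) (hMK : M ≤ K) (hMK' : M < K)
    (P : Protocol K M F E) (hP : P.IsWPrivate hM' hMK) (hR : P.IsRecoverable hM' hMK) :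
    P.rate hM' hMK ≤ 1 / 2 := by
  rw [isRecoverable_iff] at hR
  refine (P.rate_le hM' hMK two_pos fun w₀ T₀ hw₀ q hq a => ?_).trans_eq (by simp)
  choose T hT hqT using hP.exists_side hw₀ hq
  obtain ⟨w, v, d', hdv, hdw, h1, h2⟩ := exists_direction_pair hM hMK' T hT
  obtain ⟨d, hd, hTd⟩ := exists_direction (by omega) (T w) w
  exact card_fibre_mul_sq_le
    (fun X X' hX hX' => hR w (T w) (hT w) q (hqT w) X X' (hX.trans hX'.symm))
    (fun X X' hX hX' => hR v (T v) (hT v) q (hqT v) X X' (hX.trans hX'.symm))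
    hd hTd hdv hdw h1 h2

end Protocol

/-! ### A sufficient condition for privacy. -/

/-- If the joint law ignores the first coordinate, both sides equal `1 / |α|`. -/
theorem PMF_prod_div_map_snd {α β : Type} [Fintype α] [Nonempty α] (ρ : PMF (α × β))
    (h : ∀ w w' q, ρ (w, q) = ρ (w', q)) (w : α) (q : β) (hq : (ρ.map Prod.snd) q ≠ 0) :
    ρ (w, q) / (ρ.map Prod.snd) q = (ρ.map Prod.fst) w := by
  classical
  have hsnd : (ρ.map Prod.snd) q = Fintype.card α * ρ (w, q) := by
    rw [PMF.map_apply, ENNReal.tsum_prod']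
    simp only [tsum_ite_eq']
    rw [tsum_fintype, Finset.sum_congr rfl fun w' _ => h w' w q]
    simp
  have hfst : ∀ w, (ρ.map Prod.fst) w = ∑' q, ρ (w, q) := fun w => by
    rw [PMF.map_apply, ENNReal.tsum_prod', tsum_eq_single w]
    · simp
    · intro w' hw'
      simp [hw'.symm]
  have hN : (Fintype.card α : ℝ≥0∞) ≠ 0 := by simp
  have hone : Fintype.card α * (ρ.map Prod.fst) w = 1 := by
    rw [← PMF.tsum_coe (ρ.map Prod.fst), tsum_fintype,
      Finset.sum_congr rfl fun w' _ => (hfst w').trans (tsum_congr fun q => h w' w q), ← hfst w]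
    simp
  rw [hsnd] at hq ⊢
  have h0 : ρ (w, q) ≠ 0 := right_ne_zero_of_mul hq
  have h1 : ρ (w, q) / (Fintype.card α * ρ (w, q)) = 1 / Fintype.card α := by
    rw [← ENNReal.mul_div_mul_right 1 _ h0 (PMF.apply_ne_top _ _), one_mul]
  rw [h1, ← hone, mul_comm, ENNReal.mul_div_cancel_right hN (by simp)]

namespace Protocol

variable {K M : ℕ} {F E : Type} [Field F] [Fintype F] [Field E] [Fintype E] [Algebra F E]

open Classical in
theorem isWPrivate_of_forall_eq [NeZero K] (hM : 1 ≤ M) (hMK : M ≤ K) (P : Protocol K M F E)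
    (h : ∀ w w' q, (∑' T : SideInfo K M F, if w ∈ T.1.1 then P.query w T q else 0) =
      ∑' T : SideInfo K M F, if w' ∈ T.1.1 then P.query w' T q else 0) :
    P.IsWPrivate hM hMK := by
  obtain ⟨κ, -, hκ⟩ := exists_instanceLaw_apply hM hMK F
  set ρ := (P.law hM hMK).map fun ω => (P.demand ω, P.sentQuery ω) with hρ
  have hjoint : ∀ w q, ρ (w, q) =
      κ * ∑' T : SideInfo K M F, if w ∈ T.1.1 then P.query w T q else 0 := fun w q => by
    have hρ' : ρ = (instanceLaw hM hMK F).bind fun I => (P.query I.1 I.2).map fun Q => (I.1, Q) := by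
      rw [hρ, law, PMF.map_bind]
      congr 1
      funext I
      rw [PMF.map_bind, ← PMF.bind_pure_comp]
      congr 1
      funext Q
      rw [PMF.map_comp]
      exact PMF.map_const (PMF.uniformOfFintype (Fin K → E)) (I.1, Q)
    rw [hρ', PMF.bind_apply, ENNReal.tsum_prod', tsum_eq_single w, ← ENNReal.tsum_mul_left]
    · refine tsum_congr fun T => ?_
      rw [hκ, PMF.map_apply, tsum_eq_single q]
      · split_ifs <;> simp_all
      · intro q' hq'
        simp [hq'.symm]
    · intro w' hw'
      simp [PMF.map_apply, hw'.symm]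
  have hsnd : (P.law hM hMK).map P.sentQuery = ρ.map Prod.snd := by
    rw [hρ, PMF.map_comp]; rfl
  have hfst : (P.law hM hMK).map P.demand = ρ.map Prod.fst := by
    rw [hρ, PMF.map_comp]; rfl
  intro w q hq
  rw [hsnd] at hq ⊢
  rw [hfst]
  refine PMF_prod_div_map_snd ρ (fun w w' q => ?_) w q hq
  rw [hjoint, hjoint, h w w' q]

end Protocol

/-! ### Masking as a bijection. -/

section Mask

variable {ι F : Type} [DecidableEq ι] [Field F] [DecidableEq F]

/-- Hide the demand `w` in a coefficient vector `c` with `c w ≠ 0`: if the index `i` lies in the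
support of `c`, then the sign of the coefficient of `w` is changed, and otherwise this coefficient
is moved from `w` to `i`. -/
def mask (w i : ι) (c : ι → F) : ι → F :=
  if c i ≠ 0 then Function.update c w (-c w) else c ∘ Equiv.swap i w

theorem mask_apply_ne_zero {w : ι} (i : ι) {c : ι → F} (hw : c w ≠ 0) : mask w i c i ≠ 0 := by
  unfold mask
  split_ifs with h
  · by_cases hi : i = w
    · subst hi; simpa using h
    · simpa [hi] using h
  · simpa using hw

theorem card_support_mask [Fintype ι] {w : ι} (i : ι) {c : ι → F} (hw : c w ≠ 0) :
    (Finset.univ.filter fun k => mask w i c k ≠ 0).card =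
      (Finset.univ.filter fun k => c k ≠ 0).card := by
  unfold mask
  split_ifs with h
  · congr 1
    ext k
    by_cases hk : k = w
    · subst hk; simp
    · simp [hk]
  · refine Finset.card_equiv (Equiv.swap i w) fun k => ?_
    simp

/-- The masked vector remembers its branch: its entry at `w` is `-c w ≠ 0` after a sign change and
`c i = 0` after a move. Each branch is an involution. -/
theorem mask_eq_iff (w i : ι) {c c' : ι → F} (hw : c w ≠ 0) (hi : c' i ≠ 0) :
    mask w i c = c' ↔
      c = if c' w ≠ 0 then Function.update c' w (-c' w) else c' ∘ Equiv.swap i w := by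
  unfold mask
  constructor
  · rintro rfl
    by_cases h : c i = 0
    · simp only [h, ne_eq, not_true_eq_false, if_false, Function.comp_apply, Equiv.swap_apply_right]
      ext k
      simp
    · simp [h, hw]
  · intro hc
    by_cases h : c' w = 0
    · simp only [h, ne_eq, not_true_eq_false, if_false] at hc
      subst hc
      simp only [Function.comp_apply, Equiv.swap_apply_left, h, ne_eq, not_true_eq_false, if_false]
      ext k
      simp
    · simp only [h, ne_eq, not_false_eq_true, if_true] at hc
      subst hc
      have : Function.update c' w (-c' w) i ≠ 0 := by
        by_cases hiw : i = w
        · subst hiw; simpa using h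
        · simpa [hiw] using hi
      rw [if_pos this]
      simp

theorem unmask_apply_ne_zero (w i : ι) {c' : ι → F} (hi : c' i ≠ 0) :
    (if c' w ≠ 0 then Function.update c' w (-c' w) else c' ∘ Equiv.swap i w) w ≠ 0 := by
  split_ifs with h
  · simpa using h
  · simpa using hi

end Mask

/-! ### The masked protocols. -/

section Scheme

variable {K M : ℕ} {F : Type} [Field F] [DecidableEq F]

/-- The query is a uniformly random index `i` together with the coefficients of the side
information, masked with respect to `i`; the answer consists of `n` linear combinations. -/
def maskedProtocol (M : ℕ) [NeZero K] (n : ℕ)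
    (coef : Fin K × (Fin K → F) → Fin n → Fin K → F) : Protocol K M F F where
  Query := Fin K × (Fin K → F)
  Answer := Fin n → F
  query w T := (PMF.uniformOfFintype (Fin K)).map fun i => (i, mask w i (SideInfo.coeff T))
  answer q X := fun r => ∑ i, coef q r i • X i

theorem maskedProtocol_isScalarLinear [NeZero K] (n : ℕ)
    (coef : Fin K × (Fin K → F) → Fin n → Fin K → F) :
    (maskedProtocol M n coef).IsScalarLinear := by
  refine ⟨⟨List.ofFn, List.ofFn_injective⟩, fun q => List.ofFn (coef q), fun q X => ?_⟩
  rw [List.map_ofFn]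
  rfl

theorem maskedProtocol_query_apply [NeZero K] (n : ℕ)
    (coef : Fin K × (Fin K → F) → Fin n → Fin K → F) (w : Fin K) (T : SideInfo K M F) (i : Fin K)
    (c : Fin K → F) : (maskedProtocol M n coef).query w T (i, c) =
      if mask w i (SideInfo.coeff T) = c then (K : ℝ≥0∞)⁻¹ else 0 := by
  classical
  change ((PMF.uniformOfFintype (Fin K)).map fun i => (i, mask w i (SideInfo.coeff T))) (i, c) = _
  rw [PMF.map_apply, tsum_eq_single i]
  · simp [eq_comm]
  · intro i' hi'
    simp [hi'.symm]

theorem SideInfo.card_support_coeff (T : SideInfo K M F) :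
    (Finset.univ.filter fun k => SideInfo.coeff T k ≠ 0).card = M := by
  refine Eq.trans (congrArg Finset.card ?_) T.1.2
  ext k
  simp [SideInfo.coeff_ne_zero_iff, -ne_eq]

theorem card_support_unmask (w i : Fin K) {c : Fin K → F} (hi : c i ≠ 0)
    (hc : (Finset.univ.filter fun k => c k ≠ 0).card = M) :
    (Finset.univ.filter fun k => (if c w ≠ 0 then Function.update c w (-c w)
      else c ∘ Equiv.swap i w) k ≠ 0).card = M := by
  rw [← card_support_mask i (unmask_apply_ne_zero w i hi),
    (mask_eq_iff w i (unmask_apply_ne_zero w i hi) hi).2 rfl, hc]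

open Classical in
-- By bijectivity of masking, exactly one side information containing `w` yields an admissible
-- query, so the sum is free of `w`.
theorem tsum_maskedProtocol_query [NeZero K] (n : ℕ)
    (coef : Fin K × (Fin K → F) → Fin n → Fin K → F) (w i : Fin K) (c : Fin K → F) :
    (∑' T : SideInfo K M F,
      if w ∈ T.1.1 then (maskedProtocol M n coef).query w T (i, c) else 0) =
      if c i ≠ 0 ∧ (Finset.univ.filter fun k => c k ≠ 0).card = M then (K : ℝ≥0∞)⁻¹ else 0 := by
  simp only [maskedProtocol_query_apply]
  by_cases hgood : c i ≠ 0 ∧ (Finset.univ.filter fun k => c k ≠ 0).card = M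
  · obtain ⟨T₀, hT₀⟩ := SideInfo.exists_coeff_eq _ (card_support_unmask w i hgood.1 hgood.2)
    have hw₀ := unmask_apply_ne_zero w i hgood.1
    rw [if_pos hgood, tsum_eq_single T₀]
    · rw [if_pos, if_pos]
      · rw [mask_eq_iff w i _ hgood.1, hT₀]
        rw [hT₀]; exact hw₀
      · rw [← SideInfo.coeff_ne_zero_iff, hT₀]; exact hw₀
    · intro T hT
      by_cases hw : w ∈ T.1.1
      · rw [if_pos hw, if_neg]
        rw [← SideInfo.coeff_ne_zero_iff] at hw
        rw [mask_eq_iff w i hw hgood.1, ← hT₀]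
        exact fun h => hT (SideInfo.coeff_injective h)
      · rw [if_neg hw]
  · rw [if_neg hgood, ENNReal.tsum_eq_zero]
    intro T
    by_cases hw : w ∈ T.1.1
    · rw [if_pos hw, if_neg]
      rintro rfl
      rw [← SideInfo.coeff_ne_zero_iff] at hw
      exact hgood ⟨mask_apply_ne_zero i hw, by rw [card_support_mask i hw, T.card_support_coeff]⟩
    · rw [if_neg hw]

variable [Fintype F]

theorem maskedProtocol_isWPrivate [NeZero K] (hM : 1 ≤ M) (hMK : M ≤ K) (n : ℕ)
    (coef : Fin K × (Fin K → F) → Fin n → Fin K → F) :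
    (maskedProtocol M n coef).IsWPrivate hM hMK := by
  refine Protocol.isWPrivate_of_forall_eq hM hMK _ ?_
  rintro w w' ⟨i, c⟩
  exact (tsum_maskedProtocol_query n coef w i c).trans (tsum_maskedProtocol_query n coef w' i c).symm

/-- The hypothesis puts a nonzero multiple of the unit vector at `w` in the span of the answer rows
and the side information. -/
theorem maskedProtocol_isRecoverable [NeZero K] (hM : 1 ≤ M) (hMK : M ≤ K) (n : ℕ)
    (coef : Fin K × (Fin K → F) → Fin n → Fin K → F)
    (h : ∀ (w : Fin K) (T : SideInfo K M F) (i : Fin K), w ∈ T.1.1 →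
      ∃ (a : F) (lam : Fin n → F) (mu : F), a ≠ 0 ∧
        ∀ k, ∑ r, lam r * coef (i, mask w i (SideInfo.coeff T)) r k + mu * SideInfo.coeff T k =
          if k = w then a else 0) :
    (maskedProtocol M n coef).IsRecoverable hM hMK := by
  rw [Protocol.isRecoverable_iff]
  intro w T hw q hq X X' hA hY
  obtain ⟨i, -, rfl⟩ := (PMF.mem_support_map_iff _ _ _).1 hq
  obtain ⟨a, lam, mu, ha, hid⟩ := h w T i hw
  have key : ∀ X : Fin K → F, a * X w =
      ∑ r, lam r * (maskedProtocol M n coef).answer (i, mask w i (SideInfo.coeff T)) X r +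
        mu * codedSideInfo T X := fun X => by
    have h1 : a * X w = ∑ k, (if k = w then a else 0) * X k := by simp
    rw [h1, SideInfo.codedSideInfo_eq]
    simp only [← hid, add_mul, Finset.sum_add_distrib, Finset.sum_mul, Finset.mul_sum,
      maskedProtocol, smul_eq_mul, mul_assoc]
    rw [Finset.sum_comm]
  refine mul_left_cancel₀ ha ?_
  rw [key X, key X', hA, hY]

theorem le_maskedProtocol_rate [NeZero K] (hM : 1 ≤ M) (hMK : M ≤ K) (n : ℕ)
    (coef : Fin K × (Fin K → F) → Fin n → Fin K → F) :
    1 / n ≤ (maskedProtocol M n coef).rate hM hMK :=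
  Protocol.le_rate hM hMK _ (Equiv.refl _)

theorem le_scalarLinearCapacity [NeZero K] (hM : 1 ≤ M) (hMK : M ≤ K) (n : ℕ)
    (coef : Fin K × (Fin K → F) → Fin n → Fin K → F)
    (h : ∀ (w : Fin K) (T : SideInfo K M F) (i : Fin K), w ∈ T.1.1 →
      ∃ (a : F) (lam : Fin n → F) (mu : F), a ≠ 0 ∧
        ∀ k, ∑ r, lam r * coef (i, mask w i (SideInfo.coeff T)) r k + mu * SideInfo.coeff T k =
          if k = w then a else 0) :
    1 / n ≤ scalarLinearCapacity K M hM hMK :=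
  le_sSup_of_le ⟨F, F, inferInstance, inferInstance, inferInstance, inferInstance, inferInstance,
    maskedProtocol M n coef, maskedProtocol_isScalarLinear n coef,
    maskedProtocol_isWPrivate hM hMK n coef, maskedProtocol_isRecoverable hM hMK n coef h, rfl⟩
    (le_maskedProtocol_rate hM hMK n coef)

end Scheme

/-! ### Values of the capacities. -/

theorem scalarLinearCapacity_le_capacity {K M : ℕ} (hM : 1 ≤ M) (hMK : M ≤ K) :
    scalarLinearCapacity K M hM hMK ≤ capacity K M hM hMK := by
  refine sSup_le_sSup ?_
  rintro r ⟨F, E, _, _, _, _, _, P, -, hP, hR, rfl⟩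
  exact ⟨F, E, _, _, _, _, _, P, hP, hR, rfl⟩

theorem one_le_scalarLinearCapacity_of_eq {K M : ℕ} (hM : 1 ≤ M) (hMK : M ≤ K) (h : M = K) :
    1 ≤ scalarLinearCapacity K M hM hMK := by
  have : NeZero K := ⟨by omega⟩
  refine le_of_eq_of_le (by simp) (le_scalarLinearCapacity (F := ZMod 3) hM hMK 1
    (fun q _ => q.2) fun w T i hw => ?_)
  have hi : i ∈ T.1.1 := by
    have : T.1.1 = Finset.univ := Finset.eq_univ_of_card _ (by rw [T.1.2, h, Fintype.card_fin])
    simp [this]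
  rw [← SideInfo.coeff_ne_zero_iff] at hw hi
  -- The sign change leaves a difference `2 c_w X_w`, nonzero because the characteristic is 3.
  refine ⟨2 * SideInfo.coeff T w, fun _ => -1, 1, mul_ne_zero (by decide) hw, fun k => ?_⟩
  rw [mask, if_pos hi]
  by_cases hk : k = w
  · subst hk
    simp
    ring
  · simp [hk]

theorem one_le_scalarLinearCapacity_two {K : ℕ} (hM : 1 ≤ 2) (hMK : 2 ≤ K) :
    1 ≤ scalarLinearCapacity K 2 hM hMK := by
  have : NeZero K := ⟨by omega⟩
  refine le_of_eq_of_le (by simp) (le_scalarLinearCapacity (F := ZMod 3) hM hMK 1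
    (fun q _ => Function.update q.2 q.1 0) fun w T i hw => ?_)
  have hw' := (SideInfo.coeff_ne_zero_iff T w).2 hw
  by_cases hi : i ∈ T.1.1
  · have hi' := (SideInfo.coeff_ne_zero_iff T i).2 hi
    rw [mask, if_pos hi']
    by_cases hiw : i = w
    · subst hiw
      refine ⟨SideInfo.coeff T i, fun _ => -1, 1, hw', fun k => ?_⟩
      by_cases hk : k = i
      · subst hk; simp
      · simp [hk]
    -- With the support equal to `{i, w}`, deleting the entry at `i` leaves only `-c_w X_w`, so the
    -- side information is not used.
    · refine ⟨SideInfo.coeff T w, fun _ => -1, 0, hw', fun k => ?_⟩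
      by_cases hk : k = w
      · subst hk; simp [Ne.symm hiw]
      · by_cases hki : k = i
        · subst hki; simp [hk]
        · have hT : ({i, w} : Finset (Fin K)) = T.1.1 := Finset.eq_of_subset_of_card_le
            (by simp [Finset.insert_subset_iff, hi, hw])
            (by rw [T.1.2, Finset.card_pair hiw])
          have : SideInfo.coeff T k = 0 := SideInfo.coeff_eq_zero T (by rw [← hT]; simp [hk, hki])
          simp [hk, hki, this]
  · have hi' := SideInfo.coeff_eq_zero T hi
    have hiw : i ≠ w := fun e => hi (e ▸ hw)
    rw [mask, if_neg (not_not.2 hi')]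
    refine ⟨SideInfo.coeff T w, fun _ => -1, 1, hw', fun k => ?_⟩
    by_cases hk : k = w
    · subst hk; simp [hiw.symm, hi']
    · by_cases hki : k = i
      · subst hki; simp [hk, hi']
      · simp [hk, hki, Equiv.swap_apply_of_ne_of_ne]

theorem half_le_scalarLinearCapacity {K M : ℕ} (hM : 1 ≤ M) (hMK : M ≤ K) :
    1 / 2 ≤ scalarLinearCapacity K M hM hMK := by
  have : NeZero K := ⟨by omega⟩
  refine le_of_eq_of_le (by simp) (le_scalarLinearCapacity (F := ZMod 3) hM hMK 2
    (fun q => ![Pi.single q.1 1, q.2]) fun w T i hw => ?_)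
  have hw' := (SideInfo.coeff_ne_zero_iff T w).2 hw
  by_cases hi : i ∈ T.1.1
  · have hi' := (SideInfo.coeff_ne_zero_iff T i).2 hi
    refine ⟨2 * SideInfo.coeff T w, ![0, -1], 1, mul_ne_zero (by decide) hw', fun k => ?_⟩
    rw [mask, if_pos hi', Fin.sum_univ_two]
    by_cases hk : k = w
    · subst hk
      simp
      ring
    · simp [hk]
  · have hi' := SideInfo.coeff_eq_zero T hi
    have hiw : i ≠ w := fun e => hi (e ▸ hw)
    -- The difference is `c_w (X_w - X_i)`; the answer `X_i` cancels the second term.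
    refine ⟨SideInfo.coeff T w, ![SideInfo.coeff T w, -1], 1, hw', fun k => ?_⟩
    rw [mask, if_neg (not_not.2 hi'), Fin.sum_univ_two]
    by_cases hk : k = w
    · subst hk; simp [hiw.symm, hi']
    · by_cases hki : k = i
      · subst hki; simp [hk, hi']
      · simp [hk, hki, Equiv.swap_apply_of_ne_of_ne]

theorem capacity_le_one {K M : ℕ} (hM : 2 ≤ M) (hM' : 1 ≤ M) (hMK : M ≤ K) :
    capacity K M hM' hMK ≤ 1 := by
  refine sSup_le ?_
  rintro r ⟨F, E, _, _, _, _, _, P, -, hR, rfl⟩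
  exact P.rate_le_one hM hM' hMK hR

theorem capacity_le_half {K M : ℕ} (hM : 3 ≤ M) (hM' : 1 ≤ M) (hMK : M ≤ K) (hMK' : M < K) :
    capacity K M hM' hMK ≤ 1 / 2 := by
  refine sSup_le ?_
  rintro r ⟨F, E, _, _, _, _, _, P, hP, hR, rfl⟩
  exact P.rate_le_half hM hM' hMK hMK' hP hR

end PIRCSI
end

theorem theorem4 (K M : ℕ) (hM : 2 ≤ M) (hMK : M ≤ K) :
    ((M = 2 ∨ M = K) →
      PIRCSI.capacity K M (one_le_two.trans hM) hMK = 1 ∧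
      PIRCSI.scalarLinearCapacity K M (one_le_two.trans hM) hMK = 1) ∧
    (3 ≤ M ∧ M ≤ K - 1 →
      PIRCSI.capacity K M (one_le_two.trans hM) hMK = 1 / 2 ∧
      PIRCSI.scalarLinearCapacity K M (one_le_two.trans hM) hMK = 1 / 2) := by
  have hle := PIRCSI.scalarLinearCapacity_le_capacity (one_le_two.trans hM) hMK
  constructor
  · intro h
    have hup := PIRCSI.capacity_le_one hM (one_le_two.trans hM) hMK
    have hlow : 1 ≤ PIRCSI.scalarLinearCapacity K M (one_le_two.trans hM) hMK := by
      rcases h with rfl | h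
      · exact PIRCSI.one_le_scalarLinearCapacity_two _ hMK
      · exact PIRCSI.one_le_scalarLinearCapacity_of_eq _ hMK h
    exact ⟨hup.antisymm (hlow.trans hle), (hle.trans hup).antisymm hlow⟩
  · rintro ⟨h3, hK⟩
    have hup := PIRCSI.capacity_le_half h3 (one_le_two.trans hM) hMK (by omega)
    have hlow := PIRCSI.half_le_scalarLinearCapacity (one_le_two.trans hM) hMK
    exact ⟨hup.antisymm (hlow.trans hle), (hle.trans hup).antisymm hlow⟩
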